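/- Let $G$ be a finite connected graph without loops (parallel edges allowed) with $n\ge 2$ vertices, called parties, and edge set $E$. For each edge $e$, joining parties $i$ and $j$, let $\psi_e\in\mathbb{C}^{d_e}\otimes\mathbb{C}^{d'_e}$ be a unit vector, of arbitrary finite local dimensions, which is entangled (not a product vector $a\otimes b$); one of its two particles is held by party $i$, the other by party $j$. The network state is $\Psi=\bigotimes_{e\in E}\psi_e$, and the Hilbert space of each party is the tensor product of the spaces of all the particles it holds. If each party $i$, on input $\chi_i$, performs a POVM $\{F^i_{\alpha_i|\chi_i}\}_{\alpha_i}$ on its space (finitely many inputs and outputs), the resulting distribution is $$P(\alpha_1\dots\alpha_n|\chi_1\dots\chi_n)=\operatorname{tr}\Big(\bigotimes_{i=1}^n F^i_{\alpha_i|\chi_i}\,|\Psi\rangle\langle\Psi|\Big).$$ A conditional probability distribution $P$ is genuinely multipartite nonlocal (GMNL) if it cannot be written as $$P(\alpha|\chi)=\sum_{\emptyset\ne M\subsetneq[n]}\ \sum_{\lambda} q_M(\lambda)\,P_M\big((\alpha_i)_{i\in M}|(\chi_i)_{i\in M},\lambda\big)\,P_{\overline M}\big((\alpha_i)_{i\notin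 M}|(\chi_i)_{i\notin M},\lambda\big)$$ with finitely many $\lambda$, $q_M(\lambda)\ge 0$, $\sum_{M,\lambda}q_M(\lambda)=1$, and all $P_M(\cdot|\cdot,\lambda)$, $P_{\overline M}(\cdot|\cdot,\lambda)$ nonsignalling conditional probability distributions (the marginal obtained by summing over the output of any one party does not depend on the input of that party). Theorem. Every such network is GMNL: there are local measurements of the parties, with finitely many inputs and outputs, for which $P$ is GMNL. Moreover, the measurements can be chosen so that each party measures each of its particles individually, with one input and one output per particle. -/

import Mathlib

open scoped ComplexOrder

universe u w

/-! ### Multipartite conditional probability distributions -/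

/-- A family of real numbers `P χ α = P(α | χ)`, for parties `v : I` with inputs `χ v : X v`
and outputs `α v : A v`. -/
abbrev Behavior {I : Type*} (X A : I → Type*) : Type _ :=
  (∀ v, X v) → (∀ v, A v) → ℝ

namespace Behavior

/-- `P(· | χ)` is a probability distribution for every input `χ`. -/
structure IsDistribution {I : Type*} [Fintype I] [DecidableEq I] {X A : I → Type*}
    [∀ v, Fintype (A v)] (P : Behavior X A) : Prop where
  nonneg : ∀ χ α, 0 ≤ P χ α
  sum_eq_one : ∀ χ, ∑ α, P χ α = 1

/-- A nonsignalling distribution: summing over the output of any single party `j` gives a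
marginal that does not depend on the input of `j`. -/
structure IsNonsignalling {I : Type*} [Fintype I] [DecidableEq I] {X A : I → Type*}
    [∀ v, Fintype (A v)] (P : Behavior X A) : Prop extends IsDistribution P where
  no_signal : ∀ (j : I) (χ : ∀ v, X v) (x' : X j) (α : ∀ v, A v),
    ∑ a : A j, P χ (Function.update α j a) =
      ∑ a : A j, P (Function.update χ j x') (Function.update α j a)

/-- `P` is a convex mixture of distributions that factorize across some bipartition
`M | Mᶜ` of the parties (`∅ ≠ M ≠ I`), with nonsignalling factors. -/
def IsBilocalMixture {I : Type*} [Fintype I] [DecidableEq I] {X A : I → Type*}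
    [∀ v, Fintype (A v)] (P : Behavior X A) : Prop :=
  ∃ (m : ℕ) (q : Finset I → Fin m → ℝ)
    (PM : ∀ (M : Finset I), Fin m →
      Behavior (fun v : {v // v ∈ M} => X v) (fun v : {v // v ∈ M} => A v))
    (PMc : ∀ (M : Finset I), Fin m →
      Behavior (fun v : {v // v ∉ M} => X v) (fun v : {v // v ∉ M} => A v)),
    (∀ M l, 0 ≤ q M l) ∧
    (∑ M : Finset I with M ≠ ∅ ∧ M ≠ Finset.univ, ∑ l, q M l = 1) ∧
    (∀ M, M ≠ ∅ → M ≠ Finset.univ → ∀ l,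
      (PM M l).IsNonsignalling ∧ (PMc M l).IsNonsignalling) ∧
    ∀ χ α, P χ α = ∑ M : Finset I with M ≠ ∅ ∧ M ≠ Finset.univ, ∑ l,
      q M l * PM M l (fun v => χ v) (fun v => α v) * PMc M l (fun v => χ v) (fun v => α v)

/-- Genuine multipartite nonlocality of a conditional probability distribution. -/
def IsGMNL {I : Type*} [Fintype I] [DecidableEq I] {X A : I → Type*}
    [∀ v, Fintype (A v)] (P : Behavior X A) : Prop :=
  P.IsDistribution ∧ ¬ P.IsBilocalMixture

end Behavior

/-! ### Measurements and tensor products, in coordinates -/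

/-- The tensor product of finitely many operators, as a matrix in the product basis. -/
def tensorOp {I : Type*} [Fintype I] {ι : I → Type*} (M : ∀ i, Matrix (ι i) (ι i) ℂ) :
    Matrix (∀ i, ι i) (∀ i, ι i) ℂ :=
  Matrix.of fun x y => ∏ i, M i (x i) (y i)

/-- A family of POVMs on `ℂ^ι`, one for each input `x : X`, with outputs in `A`. -/
structure Measurement (ι : Type*) [Fintype ι] [DecidableEq ι] (X A : Type*) [Fintype A] where
  op : X → A → Matrix ι ι ℂ
  posSemidef : ∀ x a, (op x a).PosSemidef
  sum_eq_one : ∀ x, ∑ a, op x a = 1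

theorem tensorOp_posSemidef {I : Type*} [Fintype I] [DecidableEq I] {ι : I → Type*}
    [∀ i, Fintype (ι i)] [∀ i, DecidableEq (ι i)] (M : ∀ i, Matrix (ι i) (ι i) ℂ)
    (h : ∀ i, (M i).PosSemidef) : (tensorOp M).PosSemidef := by
  have h' : ∀ i, ∃ B : Matrix (ι i) (ι i) ℂ, M i = B.conjTranspose * B := fun i => by
    open scoped MatrixOrder in
    exact CStarAlgebra.nonneg_iff_eq_star_mul_self.mp (h i).nonneg
  choose B hB using h'
  have key : tensorOp M = (tensorOp B).conjTranspose * tensorOp B := by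
    ext x y
    simp only [tensorOp, Matrix.of_apply, Matrix.mul_apply, Matrix.conjTranspose_apply, hB,
      star_prod, ← Finset.prod_mul_distrib]
    rw [Finset.prod_univ_sum, Fintype.piFinset_univ]
  rw [key]
  exact Matrix.posSemidef_conjTranspose_mul_self _

/-- Measuring finitely many particles individually: inputs and outputs are tuples with one
component per particle, and the operators are tensor products. -/
def Measurement.tensor {I : Type*} [Fintype I] [DecidableEq I] {ι X A : I → Type*}
    [∀ i, Fintype (ι i)] [∀ i, DecidableEq (ι i)] [∀ i, Fintype (A i)]
    (F : ∀ i, Measurement (ι i) (X i) (A i)) :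
    Measurement (∀ i, ι i) (∀ i, X i) (∀ i, A i) where
  op x a := tensorOp fun i => (F i).op (x i) (a i)
  posSemidef x a := tensorOp_posSemidef _ fun i => (F i).posSemidef (x i) (a i)
  sum_eq_one x := by
    ext y z
    have h : ∀ i, ∑ a, (F i).op (x i) a (y i) (z i) = (1 : Matrix (ι i) (ι i) ℂ) (y i) (z i) :=
      fun i => by rw [← (F i).sum_eq_one (x i), Matrix.sum_apply]
    rw [Matrix.sum_apply]
    simp only [tensorOp, Matrix.of_apply]
    rw [← Fintype.piFinset_univ, ← Finset.prod_univ_sum (fun _ => Finset.univ)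
      (fun i a => (F i).op (x i) a (y i) (z i))]
    simp only [h, Matrix.one_apply]
    rw [Fintype.prod_ite_zero]
    simp [funext_iff]

/-! ### Networks of bipartite pure states -/

/-- A network: a finite loopless multigraph with vertices (parties) `V` and edges `E`, where
edge `e` carries a pure state of two particles, namely a unit vector of
`ℂ^(dim e 0) ⊗ ℂ^(dim e 1)`. Particle `s : Fin 2` of edge `e` is held by party `ends e s`. -/
structure Network (V : Type u) (E : Type w) where
  ends : E → Fin 2 → V
  ends_ne : ∀ e, ends e 0 ≠ ends e 1
  dim : E → Fin 2 → ℕ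
  state : ∀ e, EuclideanSpace ℂ (Fin (dim e 0) × Fin (dim e 1))
  norm_state : ∀ e, ‖state e‖ = 1

namespace Network

variable {V : Type u} {E : Type w}

/-- Two parties are adjacent when they share at least one edge. -/
def graph (N : Network V E) : SimpleGraph V :=
  SimpleGraph.fromRel fun u v => ∃ e, N.ends e 0 = u ∧ N.ends e 1 = v

/-- The state on edge `e` is entangled: it is not a product vector. -/
def IsEntangled (N : Network V E) (e : E) : Prop :=
  ¬ ∃ (a : Fin (N.dim e 0) → ℂ) (b : Fin (N.dim e 1) → ℂ), ∀ i j, N.state e (i, j) = a i * b j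

/-- The particles held by party `v`. -/
abbrev Held (N : Network V E) (v : V) : Type w :=
  {p : E × Fin 2 // N.ends p.1 p.2 = v}

/-- Basis labels of the Hilbert space of all particles. -/
abbrev GlobalIndex (N : Network V E) : Type w :=
  ∀ p : E × Fin 2, Fin (N.dim p.1 p.2)

/-- Basis labels of the Hilbert space of party `v`, the tensor product of the spaces of the
particles that `v` holds. -/
abbrev PartyIndex (N : Network V E) (v : V) : Type w :=
  ∀ p : N.Held v, Fin (N.dim p.1.1 p.1.2)

/-- Regrouping the particles by the parties that hold them. -/
def regroup (N : Network V E) (i : N.GlobalIndex) (v : V) : N.PartyIndex v :=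
  fun p => i p.1

/-- The global state vector, the tensor product of the states on all edges. -/
def globalState [Fintype E] (N : Network V E) : N.GlobalIndex → ℂ :=
  fun i => ∏ e, N.state e (i (e, 0), i (e, 1))

/-- The global density matrix `|Ψ⟩⟨Ψ|`. -/
def density [Fintype E] (N : Network V E) : Matrix N.GlobalIndex N.GlobalIndex ℂ :=
  Matrix.vecMulVec N.globalState (star N.globalState)

variable [Fintype V] [DecidableEq V] [Fintype E] [DecidableEq E]

/-- The Born rule `P(α | χ) = tr ((⨂ᵥ F^v_{α v | χ v}) ρ)` when each party `v` performs the
local measurement `F v` on all the particles it holds. -/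
noncomputable def distribution (N : Network V E) {X A : V → Type*} [∀ v, Fintype (A v)]
    (F : ∀ v, Measurement (N.PartyIndex v) (X v) (A v)) : Behavior X A :=
  fun χ α => (Matrix.trace
    ((tensorOp fun v => (F v).op (χ v) (α v)).submatrix N.regroup N.regroup * N.density)).re

/-- The network state is GMNL: some local measurements of the parties, with finitely many
inputs and outputs, give rise to a GMNL distribution. -/
def IsGMNL (N : Network V E) : Prop :=
  ∃ (X A : V → Type w) (_ : ∀ v, Finite (X v)) (_ : ∀ v, Fintype (A v))
    (F : ∀ v, Measurement (N.PartyIndex v) (X v) (A v)),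
    (N.distribution F).IsGMNL

/-- The same, with every party measuring each of its particles individually: party `v` has
one input and one output for each of the particles that it holds. -/
def IsGMNLParticlewise (N : Network V E) : Prop :=
  ∃ (nX nA : E × Fin 2 → ℕ)
    (F : ∀ p : E × Fin 2, Measurement (Fin (N.dim p.1 p.2)) (Fin (nX p)) (Fin (nA p))),
    (N.distribution fun v => Measurement.tensor fun p : N.Held v => F p.1).IsGMNL

end Network

/-!
On every edge the two particles are measured in a chain of binary settings `0, 1, …, K` with `K`
odd, even settings for the first particle and odd ones for the second. If the answers are local,
output `0` at setting `0` and output `1` at setting `K` force an error in between, that is, output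
`0` at some setting `k` and output `1` at setting `k + 1`; so the probability of the former is at
most the sum of the error probabilities (`local_le_sum_chainError`). An entangled state violates
this strongly (`exists_chain_measurement`): the left-hand side can be kept above a constant `p >
0` that depends on the state alone, while the sum of the errors is arbitrarily small. To see this,
take two terms of the Schmidt decomposition. If their coefficients `s₀, s₁` differ, the directions
`(s₀ᵏ, s₁ᵏ)` make no error at all, which is Hardy's paradox; if they agree, turning the direction
by a right angle in many small steps makes errors of total order `1 / K`, which is the chained
Bell inequality.

For the network, consider the event that on every edge the chain starts in `0` and ends in `1`.
The edges are independent (`Network.distribution_tensor`), so this event has probability at least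
`∏ e, p e`, whatever the bound on the errors is. In a mixture over bipartitions, on the other
hand, every term is a product across some `M | Mᶜ`, and since the network is connected some edge
crosses this bipartition. The term is local on that edge when the settings of the other edges are
held fixed (`Network.exists_local_edgeMarginal`), so it gives the event at most the weight that it
gives to the errors on that edge, a fortiori to the errors on all edges together. Summing over the
terms, the event has probability at most the total error of all chains
(`Network.le_totalError_of_isBilocalMixture`), a contradiction once that is below `∏ e, p e`.
-/

/-! ### The chained inequality -/

/-- The `k`-th error event of a chain of settings `0, 1, 2, …` whose even members belong to the
first particle and whose odd members belong to the second: setting `k` has output `0` although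
setting `k + 1` has output `1`. Here `Q x y a b` is the probability of the outputs `a, b` on
inputs `x, y`. -/
def chainError (Q : ℕ → ℕ → Fin 2 → Fin 2 → ℝ) (k : ℕ) : ℝ :=
  if Even k then Q k (k + 1) 0 1 else Q (k + 1) k 1 0

/-- A local distribution with output `0` at setting `0` and output `1` at setting `K` has to make
one of the errors of the chain in between. -/
theorem local_le_sum_chainError {f g : ℕ → Fin 2 → ℝ} (hf : ∀ k a, 0 ≤ f k a)
    (hg : ∀ k a, 0 ≤ g k a) (hf1 : ∀ k, ∑ a, f k a = 1) (hg1 : ∀ k, ∑ a, g k a = 1)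
    {K : ℕ} (hK : Odd K) :
    f 0 0 * g K 1 ≤ ∑ k ∈ Finset.range K, chainError (fun x y a b => f x a * g y b) k := by
  simp only [Fin.sum_univ_two] at hf1 hg1
  set h : ℕ → ℝ := fun k => if Even k then f k 0 else g k 0 with hh
  have h0 : ∀ k, 0 ≤ h k := fun k => by simp only [hh]; split_ifs <;> simp [hf, hg]
  have h1 : ∀ k, h k ≤ 1 := fun k => by
    simp only [hh]
    split_ifs
    · linarith [hf1 k, hf k 1]
    · linarith [hg1 k, hg k 1]
  have herr : ∀ k, chainError (fun x y a b => f x a * g y b) k = h k * (1 - h (k + 1)) := by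
    intro k
    by_cases hk : Even k
    · have hk' : ¬ Even (k + 1) := by simpa [Nat.even_add_one] using hk
      simp only [chainError, hh, hk, hk', if_true, if_false]
      rw [← hg1 (k + 1)]; ring
    · have hk' : Even (k + 1) := by simpa [Nat.even_add_one] using hk
      simp only [chainError, hh, hk, hk', if_true, if_false]
      rw [← hf1 (k + 1)]; ring
  have key : ∀ n, h 0 * (1 - h (n + 1)) ≤ ∑ k ∈ Finset.range (n + 1), h k * (1 - h (k + 1)) := by
    intro n
    induction n with
    | zero => simp
    | succ n ih =>
      rw [Finset.sum_range_succ]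
      have e1 : 0 ≤ h (n + 1) * (1 - h 0) * (1 - h (n + 2)) :=
        mul_nonneg (mul_nonneg (h0 _) (by linarith [h1 0])) (by linarith [h1 (n + 2)])
      have e2 : 0 ≤ h 0 * h (n + 2) * (1 - h (n + 1)) :=
        mul_nonneg (mul_nonneg (h0 _) (h0 _)) (by linarith [h1 (n + 1)])
      linarith
  have hKe : ¬ Even K := Nat.not_even_iff_odd.2 hK
  simp only [herr]
  obtain ⟨n, rfl⟩ : ∃ n, K = n + 1 := ⟨K - 1, by have := hK.pos; omega⟩
  refine le_of_eq_of_le ?_ (key n)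
  simp only [hh, hKe, if_false, Even.zero, if_true]
  rw [← hg1 (n + 1)]; ring

/-! ### Chains of directions in the real plane -/

/-- For the state with Schmidt coefficients `s₀, s₁`, the probability that the particle measured
in the real direction `(x₀, x₁)` is found there while the other particle, measured in the
direction `(y₀, y₁)`, is not. -/
def steeringError (s₀ s₁ x₀ x₁ y₀ y₁ : ℝ) : ℝ := (x₀ * s₀ * y₁ - x₁ * s₁ * y₀) ^ 2

/-- A chain of unit vectors in the plane whose ends are at least `p` apart, with `p` independent of
the bound `ε` on the total error of the steps. For distinct Schmidt coefficients every step can be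
free of error (Hardy's paradox); for equal ones the direction turns by a right angle in many equal
steps (the chained Bell inequality). -/
theorem exists_chain {s₀ s₁ : ℝ} (h₀ : 0 < s₀) (h₁ : 0 < s₁) :
    ∃ p > 0, ∀ ε > 0, ∃ (K : ℕ) (c d : ℕ → ℝ), Odd K ∧ (∀ k, c k ^ 2 + d k ^ 2 = 1) ∧
      p ≤ steeringError s₀ s₁ (c 0) (d 0) (c K) (d K) ∧
      ∑ k ∈ Finset.range K, steeringError s₀ s₁ (c k) (d k) (c (k + 1)) (d (k + 1)) ≤ ε := by
  by_cases hs : s₀ = s₁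
  · subst hs
    refine ⟨s₀ ^ 2, by positivity, fun ε hε => ?_⟩
    -- `K` steps of angle `t = π / (2K)` have total error at most `K s₀² t² = s₀² (π / 2)² / K`.
    obtain ⟨n, hn⟩ := exists_nat_gt (s₀ ^ 2 * (Real.pi / 2) ^ 2 / ε)
    set K : ℕ := 2 * n + 1 with hK
    have hKpos : (0 : ℝ) < K := by positivity
    set t : ℝ := Real.pi / 2 / K with ht
    have herr : ∀ a b : ℝ, steeringError s₀ s₀ (Real.cos a) (Real.sin a) (Real.cos b) (Real.sin b)
        = s₀ ^ 2 * Real.sin (b - a) ^ 2 := fun a b => by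
      rw [Real.sin_sub, steeringError]; ring
    refine ⟨K, fun k => Real.cos (k * t), fun k => Real.sin (k * t), odd_two_mul_add_one n,
      fun k => Real.cos_sq_add_sin_sq _, ?_, ?_⟩
    · have : (K : ℝ) * t - (0 : ℕ) * t = Real.pi / 2 := by rw [ht]; field_simp; simp
      rw [herr, this]; simp
    · have hstep : ∀ k : ℕ, ((k + 1 : ℕ) : ℝ) * t - k * t = t := fun k => by push_cast; ring
      simp only [herr, hstep, Finset.sum_const, Finset.card_range, nsmul_eq_mul]
      have h1 : Real.sin t ^ 2 ≤ t ^ 2 := sq_le_sq.2 Real.abs_sin_le_abs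
      have h2 : (K : ℝ) * (s₀ ^ 2 * t ^ 2) = s₀ ^ 2 * (Real.pi / 2) ^ 2 / K := by
        rw [ht]; field_simp
      have h3 : s₀ ^ 2 * (Real.pi / 2) ^ 2 / K ≤ ε := by
        rw [div_lt_iff₀ hε] at hn
        rw [div_le_iff₀ hKpos]
        have : (n : ℝ) ≤ K := by rw [hK]; push_cast; linarith [n.cast_nonneg (α := ℝ)]
        nlinarith
      calc (K : ℝ) * (s₀ ^ 2 * Real.sin t ^ 2) ≤ K * (s₀ ^ 2 * t ^ 2) := by gcongr
        _ ≤ ε := h2.trans_le h3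
  · -- The directions `(s₀ᵏ, s₁ᵏ)`, normalized: each is where the previous outcome steers the state.
    set r : ℕ → ℝ := fun k => √((s₀ ^ k) ^ 2 + (s₁ ^ k) ^ 2) with hr
    have hr2 : ∀ k, r k ^ 2 = (s₀ ^ k) ^ 2 + (s₁ ^ k) ^ 2 := fun k => Real.sq_sqrt (by positivity)
    have hr0 : ∀ k, 0 < r k := fun k => Real.sqrt_pos.2 (by positivity)
    have herr : ∀ k l, steeringError s₀ s₁ (s₀ ^ k / r k) (s₁ ^ k / r k) (s₀ ^ l / r l)
        (s₁ ^ l / r l) = ((s₀ ^ (k + 1) * s₁ ^ l - s₁ ^ (k + 1) * s₀ ^ l) / (r k * r l)) ^ 2 := by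
      intro k l
      have := (hr0 k).ne'
      have := (hr0 l).ne'
      rw [steeringError]; field_simp; ring
    refine ⟨((s₀ ^ (0 + 1) * s₁ ^ 3 - s₁ ^ (0 + 1) * s₀ ^ 3) / (r 0 * r 3)) ^ 2, ?_, fun ε hε =>
      ⟨3, fun k => s₀ ^ k / r k, fun k => s₁ ^ k / r k, by decide, fun k => ?_, ?_, ?_⟩⟩
    · have h1 : s₀ ^ (0 + 1) * s₁ ^ 3 - s₁ ^ (0 + 1) * s₀ ^ 3
          = s₀ * s₁ * (s₁ + s₀) * (s₁ - s₀) := by ring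
      have h2 : s₁ - s₀ ≠ 0 := sub_ne_zero.2 (Ne.symm hs)
      have := (hr0 0).ne'
      have := (hr0 3).ne'
      rw [h1]
      positivity
    · rw [div_pow, div_pow, ← add_div, ← hr2, div_self (pow_pos (hr0 k) 2).ne']
    · rw [herr]
    · refine (Finset.sum_nonpos fun k _ => ?_).trans hε.le
      rw [herr, mul_comm (s₀ ^ (k + 1)), sub_self, zero_div, zero_pow two_ne_zero]

/-! ### Two particles in a pure state -/

/-- The Born rule `⟨ψ, (A ⊗ B) ψ⟩` for a bipartite vector `ψ`, in coordinates. -/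
def bornPair {m n : Type*} [Fintype m] [Fintype n] (ψ : m × n → ℂ) (A : Matrix m m ℂ)
    (B : Matrix n n ℂ) : ℂ :=
  ∑ x : m × n, ∑ y : m × n, A x.1 y.1 * B x.2 y.2 * (ψ y * star (ψ x))

section BornPair

open Matrix

variable {m n : Type*} [Fintype m] [Fintype n]

theorem bornPair_eq_dotProduct (ψ : m × n → ℂ) (A : Matrix m m ℂ) (B : Matrix n n ℂ) :
    bornPair ψ A B = star ψ ⬝ᵥ (kroneckerMap (· * ·) A B *ᵥ ψ) := by
  simp only [bornPair, dotProduct, mulVec, Finset.mul_sum, kroneckerMap_apply, Pi.star_apply]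
  exact Finset.sum_congr rfl fun _ _ => Finset.sum_congr rfl fun _ _ => by ring

theorem bornPair_nonneg [DecidableEq m] [DecidableEq n] (ψ : m × n → ℂ) {A : Matrix m m ℂ}
    {B : Matrix n n ℂ} (hA : A.PosSemidef) (hB : B.PosSemidef) : 0 ≤ bornPair ψ A B := by
  rw [bornPair_eq_dotProduct]
  exact (hA.kronecker hB).dotProduct_mulVec_nonneg ψ

theorem bornPair_sum {ι κ : Type*} (s : Finset ι) (t : Finset κ) (ψ : m × n → ℂ)
    (A : ι → Matrix m m ℂ) (B : κ → Matrix n n ℂ) :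
    ∑ i ∈ s, ∑ j ∈ t, bornPair ψ (A i) (B j) = bornPair ψ (∑ i ∈ s, A i) (∑ j ∈ t, B j) := by
  have hr : ∀ i, ∑ j ∈ t, bornPair ψ (A i) (B j) = bornPair ψ (A i) (∑ j ∈ t, B j) := fun i => by
    simp only [bornPair, Matrix.sum_apply, Finset.sum_mul, Finset.mul_sum]
    rw [Finset.sum_comm]
    exact Finset.sum_congr rfl fun _ _ => Finset.sum_comm
  simp only [hr]
  simp only [bornPair, Matrix.sum_apply (s := s), Finset.sum_mul]
  rw [Finset.sum_comm]
  exact Finset.sum_congr rfl fun _ _ => Finset.sum_comm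

theorem bornPair_one [DecidableEq m] [DecidableEq n] (ψ : EuclideanSpace ℂ (m × n))
    (hψ : ‖ψ‖ = 1) : bornPair ψ 1 1 = 1 := by
  have h := EuclideanSpace.norm_sq_eq ψ
  rw [hψ] at h
  rw [bornPair_eq_dotProduct, kroneckerMap_one_one _ zero_mul mul_zero (one_mul _), one_mulVec]
  have : star (ψ : m × n → ℂ) ⬝ᵥ ψ = ((∑ i, ‖ψ i‖ ^ 2 : ℝ) : ℂ) := by
    simp [dotProduct, Complex.conj_mul']
  rw [this, ← h]; simp

/-- Finding the first particle in `u` leaves the second one in the vector `⟨u, ψ⟩`. -/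
theorem bornPair_vecMulVec_left (ψ : m × n → ℂ) (u : m → ℂ) (B : Matrix n n ℂ) {χ : n → ℂ}
    (hχ : ∀ b, χ b = ∑ a, star (u a) * ψ (a, b)) :
    bornPair ψ (vecMulVec u (star u)) B = star χ ⬝ᵥ (B *ᵥ χ) := by
  simp only [bornPair, dotProduct, mulVec, Fintype.sum_prod_type, Pi.star_apply, hχ, star_sum,
    Finset.mul_sum, Finset.sum_mul, vecMulVec_apply, star_mul', star_star]
  rw [Finset.sum_comm]
  refine Finset.sum_congr rfl fun b _ => ?_
  rw [Finset.sum_comm_cycle]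
  refine Finset.sum_congr rfl fun _ _ => ?_
  rw [Finset.sum_comm]
  exact Finset.sum_congr rfl fun _ _ => Finset.sum_congr rfl fun _ _ => by ring

theorem bornPair_vecMulVec_right (ψ : m × n → ℂ) (v : n → ℂ) (A : Matrix m m ℂ) {χ : m → ℂ}
    (hχ : ∀ a, χ a = ∑ b, star (v b) * ψ (a, b)) :
    bornPair ψ A (vecMulVec v (star v)) = star χ ⬝ᵥ (A *ᵥ χ) := by
  have h : bornPair ψ A (vecMulVec v (star v)) =
      bornPair (fun x => ψ x.swap) (vecMulVec v (star v)) A := by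
    simp only [bornPair]
    rw [← (Equiv.prodComm n m).sum_comp]
    refine Finset.sum_congr rfl fun x _ => ?_
    rw [← (Equiv.prodComm n m).sum_comp]
    exact Finset.sum_congr rfl fun y _ => by
      simp only [Equiv.prodComm_apply, Prod.fst_swap, Prod.snd_swap]; ring
  rw [h]
  exact bornPair_vecMulVec_left _ v A hχ

end BornPair

/-! ### Schmidt pairs and chains of measurements -/

section Schmidt

open Matrix

variable {m n : Type*} [Fintype m] [Fintype n]

/-- The real combination `c f₀ + d f₁` of two complex vectors. -/
def planeVec {ι : Type*} (f : Fin 2 → ι → ℂ) (c d : ℝ) : ι → ℂ :=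
  fun i => c * f 0 i + d * f 1 i

theorem star_planeVec_dotProduct {f : Fin 2 → n → ℂ}
    (hf : ∀ i j, star (f i) ⬝ᵥ f j = if i = j then 1 else 0) (x₀ x₁ y₀ y₁ : ℝ) :
    star (planeVec f x₀ x₁) ⬝ᵥ planeVec f y₀ y₁ = ((x₀ * y₀ + x₁ * y₁ : ℝ) : ℂ) := by
  have h : ∀ c d : ℝ, planeVec f c d = (c : ℂ) • f 0 + (d : ℂ) • f 1 := fun c d => rfl
  simp [h, star_add, star_smul, add_dotProduct, dotProduct_add, smul_dotProduct, dotProduct_smul,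
    hf, mul_comm]

/-- The measurements with outcome `0` for the vector `v x` and outcome `1` for its orthogonal
complement. -/
def vectorMeasurement {X : Type*} [DecidableEq n] (v : X → n → ℂ)
    (hv : ∀ x, star (v x) ⬝ᵥ v x = 1) : Measurement n X (Fin 2) where
  op x a := if a = 0 then vecMulVec (v x) (star (v x)) else 1 - vecMulVec (v x) (star (v x))
  posSemidef x a := by
    split_ifs
    · exact posSemidef_vecMulVec_self_star _
    · set P := vecMulVec (v x) (star (v x)) with hP
      have hH : Pᴴ = P := (posSemidef_vecMulVec_self_star (v x)).isHermitian
      have hPP : P * P = P := by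
        rw [hP, vecMulVec_mul_vecMulVec, hv]; simp
      have : 1 - P = (1 - P)ᴴ * (1 - P) := by
        rw [conjTranspose_sub, conjTranspose_one, hH]
        simp [sub_mul, mul_sub, hPP]
      rw [this]
      exact posSemidef_conjTranspose_mul_self _
  sum_eq_one x := by simp

theorem star_dotProduct_one_sub_mulVec [DecidableEq n] {f : Fin 2 → n → ℂ}
    (hf : ∀ i j, star (f i) ⬝ᵥ f j = if i = j then 1 else 0) (x₀ x₁ : ℝ) {y₀ y₁ : ℝ}
    (hy : y₀ ^ 2 + y₁ ^ 2 = 1) :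
    star (planeVec f x₀ x₁) ⬝ᵥ ((1 - vecMulVec (planeVec f y₀ y₁) (star (planeVec f y₀ y₁))) *ᵥ
      planeVec f x₀ x₁) = (((x₀ * y₁ - x₁ * y₀) ^ 2 : ℝ) : ℂ) := by
  rw [sub_mulVec, one_mulVec, vecMulVec_mulVec, dotProduct_sub]
  simp only [op_smul_eq_smul, dotProduct_smul, star_planeVec_dotProduct hf, smul_eq_mul]
  rw [← Complex.ofReal_mul, ← Complex.ofReal_sub]
  congr 1
  linear_combination (x₀ ^ 2 + x₁ ^ 2) * (-hy)

/-- Two terms `sᵢ eᵢ ⊗ fᵢ` of a Schmidt decomposition of `ψ`: the vectors `eᵢ` are orthonormal, so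
are the `fᵢ`, and `ψ` sends `eᵢ` to `sᵢ fᵢ` and `fᵢ` to `sᵢ eᵢ` under partial inner products. -/
structure IsSchmidtPair (ψ : m × n → ℂ) (s : Fin 2 → ℝ) (e : Fin 2 → m → ℂ)
    (f : Fin 2 → n → ℂ) : Prop where
  pos : ∀ i, 0 < s i
  left : ∀ i j, star (e i) ⬝ᵥ e j = if i = j then 1 else 0
  right : ∀ i j, star (f i) ⬝ᵥ f j = if i = j then 1 else 0
  map_left : ∀ i b, ∑ a, star (e i a) * ψ (a, b) = s i * f i b
  map_right : ∀ i a, ∑ b, star (f i b) * ψ (a, b) = s i * e i a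

variable {ψ : m × n → ℂ} {s : Fin 2 → ℝ} {e : Fin 2 → m → ℂ}
  {f : Fin 2 → n → ℂ}

/-- An entangled vector has at least two Schmidt terms. They come from eigenvectors of `T Tᴴ`, where
`T` is `ψ` read as a matrix: if `Tᴴ` killed all of an eigenbasis but one vector, `T` would have rank
at most one. -/
theorem exists_isSchmidtPair [DecidableEq m]
    (hψ : ¬ ∃ (a : m → ℂ) (b : n → ℂ), ∀ i j, ψ (i, j) = a i * b j) :
    ∃ s e f, IsSchmidtPair ψ s e f := by
  let T : Matrix m n ℂ := of fun i j => ψ (i, j)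
  have hM : (T * Tᴴ).IsHermitian := isHermitian_mul_conjTranspose_self T
  let v : m → m → ℂ := fun i => hM.eigenvectorBasis i
  let φ : m → n → ℂ := fun i => Tᴴ *ᵥ v i
  have hTφ : ∀ i, T *ᵥ φ i = (hM.eigenvalues i : ℂ) • v i := fun i => by
    rw [mulVec_mulVec]
    simpa using hM.mulVec_eigenvectorBasis i
  have hv : ∀ i j, star (v i) ⬝ᵥ v j = if i = j then 1 else 0 := fun i j => by
    have := orthonormal_iff_ite.1 hM.eigenvectorBasis.orthonormal i j
    rwa [EuclideanSpace.inner_eq_star_dotProduct, dotProduct_comm] at this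
  have hφ : ∀ i j, star (φ i) ⬝ᵥ φ j = if i = j then (hM.eigenvalues j : ℂ) else 0 := fun i j => by
    have : star (φ i) ⬝ᵥ φ j = star (v i) ⬝ᵥ (T *ᵥ φ j) := by
      rw [star_mulVec, conjTranspose_conjTranspose, ← dotProduct_mulVec]
    rw [this, hTφ, dotProduct_smul, hv]
    simp
  have hcomplete : ∀ a a', ∑ i, v i a * star (v i a') = if a = a' then 1 else 0 := fun a a' => by
    have := congrFun (congrFun (Unitary.coe_mul_star_self hM.eigenvectorUnitary) a) a'
    simpa [mul_apply, one_apply, star_apply, v] using this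
  have hφ' : ∀ i b, star (φ i b) = ∑ a, star (v i a) * ψ (a, b) := fun i b => by
    simp [φ, T, mulVec, dotProduct, mul_comm]
  have hexp : ∀ a b, ψ (a, b) = ∑ i, v i a * star (φ i b) := fun a b => by
    simp only [hφ', Finset.mul_sum, ← mul_assoc]
    rw [Finset.sum_comm]
    simp only [← Finset.sum_mul, hcomplete]
    simp
  obtain ⟨i, hi⟩ : ∃ i, φ i ≠ 0 := by
    by_contra! h
    exact hψ ⟨0, 0, fun a b => by simp [hexp, h]⟩
  obtain ⟨j, hj, hij⟩ : ∃ j, φ j ≠ 0 ∧ i ≠ j := by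
    by_contra! h
    refine hψ ⟨v i, star (φ i), fun a b => ?_⟩
    rw [hexp, Finset.sum_eq_single i (fun k _ hk => ?_) (by simp), Pi.star_apply]
    have : φ k = 0 := by
      by_contra hk0
      exact hk (h k hk0).symm
    simp [this]
  have hpos : ∀ k, φ k ≠ 0 → 0 < hM.eigenvalues k := fun k hk => by
    have h1 := dotProduct_star_self_pos_iff.2 hk
    rw [hφ, if_pos rfl] at h1
    exact_mod_cast h1
  let p : Fin 2 → m := ![i, j]
  have hp : ∀ k l, p k = p l ↔ k = l := fun k l => by
    fin_cases k <;> fin_cases l <;> simp [p, hij, hij.symm]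
  have hpp : ∀ k, 0 < hM.eigenvalues (p k) := fun k => by
    fin_cases k
    · exact hpos i hi
    · exact hpos j hj
  have hsq : ∀ k, ((√(hM.eigenvalues (p k)) : ℝ) : ℂ) * (√(hM.eigenvalues (p k)) : ℝ) =
      hM.eigenvalues (p k) := fun k => by
    rw [← Complex.ofReal_mul, Real.mul_self_sqrt (hpp k).le]
  have hne : ∀ k, ((√(hM.eigenvalues (p k)) : ℝ) : ℂ) ≠ 0 := fun k => by
    exact_mod_cast (Real.sqrt_pos.2 (hpp k)).ne'
  refine ⟨fun k => √(hM.eigenvalues (p k)), fun k => v (p k),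
    fun k b => star (φ (p k) b) / (√(hM.eigenvalues (p k)) : ℝ),
    ⟨fun k => Real.sqrt_pos.2 (hpp k), fun k l => by simp [hv, hp], fun k l => ?_, fun k b => ?_,
      fun k a => ?_⟩⟩
  · have h1 := hφ (p l) (p k)
    simp only [dotProduct, Pi.star_apply] at h1
    simp only [dotProduct, Pi.star_apply, star_div₀, star_star]
    have h2 : ∀ b, φ (p k) b / star ((√(hM.eigenvalues (p k)) : ℝ) : ℂ) *
        (star (φ (p l) b) / (√(hM.eigenvalues (p l)) : ℝ)) = star (φ (p l) b) * φ (p k) b *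
        (((√(hM.eigenvalues (p k)) : ℝ) : ℂ) * ((√(hM.eigenvalues (p l)) : ℝ) : ℂ))⁻¹ := by
      intro b
      simp only [Complex.star_def, Complex.conj_ofReal]
      field_simp
    simp only [h2, ← Finset.sum_mul, h1, hp]
    by_cases hkl : k = l
    · subst hkl
      rw [if_pos rfl, if_pos rfl, hsq, mul_inv_cancel₀]
      exact_mod_cast (hpp k).ne'
    · rw [if_neg hkl, if_neg (Ne.symm hkl), zero_mul]
  · rw [← hφ', mul_div_cancel₀ _ (hne k)]
  · have h1 := congrFun (hTφ (p k)) a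
    simp only [mulVec, dotProduct, T, of_apply, Pi.smul_apply, smul_eq_mul] at h1
    have h2 : ∀ b, star (star (φ (p k) b) / ((√(hM.eigenvalues (p k)) : ℝ) : ℂ)) * ψ (a, b) =
        ψ (a, b) * φ (p k) b * ((√(hM.eigenvalues (p k)) : ℝ) : ℂ)⁻¹ := by
      intro b
      rw [star_div₀, star_star, Complex.star_def, Complex.conj_ofReal]
      field_simp
    simp only [h2, ← Finset.sum_mul, h1]
    rw [← hsq]
    field_simp [hne k]

theorem IsSchmidtPair.bornPair_left [DecidableEq n] (h : IsSchmidtPair ψ s e f) (x₀ x₁ : ℝ)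
    {y₀ y₁ : ℝ} (hy : y₀ ^ 2 + y₁ ^ 2 = 1) :
    bornPair ψ (vecMulVec (planeVec e x₀ x₁) (star (planeVec e x₀ x₁)))
      (1 - vecMulVec (planeVec f y₀ y₁) (star (planeVec f y₀ y₁))) =
      (steeringError (s 0) (s 1) x₀ x₁ y₀ y₁ : ℂ) := by
  rw [bornPair_vecMulVec_left ψ _ _ (χ := planeVec f (x₀ * s 0) (x₁ * s 1)),
    star_dotProduct_one_sub_mulVec h.right _ _ hy, steeringError]
  intro b
  simp only [planeVec, star_add, star_mul', add_mul, Finset.sum_add_distrib, mul_assoc,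
    ← Finset.mul_sum, h.map_left]
  simp [mul_assoc]

theorem IsSchmidtPair.bornPair_right [DecidableEq m] (h : IsSchmidtPair ψ s e f) (x₀ x₁ : ℝ)
    {y₀ y₁ : ℝ} (hy : y₀ ^ 2 + y₁ ^ 2 = 1) :
    bornPair ψ (1 - vecMulVec (planeVec e y₀ y₁) (star (planeVec e y₀ y₁)))
      (vecMulVec (planeVec f x₀ x₁) (star (planeVec f x₀ x₁))) =
      (steeringError (s 0) (s 1) x₀ x₁ y₀ y₁ : ℂ) := by
  rw [bornPair_vecMulVec_right ψ _ _ (χ := planeVec e (x₀ * s 0) (x₁ * s 1)),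
    star_dotProduct_one_sub_mulVec h.left _ _ hy, steeringError]
  intro b
  simp only [planeVec, star_add, star_mul', add_mul, Finset.sum_add_distrib, mul_assoc,
    ← Finset.mul_sum, h.map_right]
  simp [mul_assoc]

/-- The outcome probabilities `Q x y a b` of binary measurements on the two particles of `ψ`, with
the inputs `0, …, K` numbered by natural numbers. -/
def chainProb [DecidableEq m] [DecidableEq n] (ψ : m × n → ℂ) {K : ℕ}
    (F : Measurement m (Fin (K + 1)) (Fin 2))
    (G : Measurement n (Fin (K + 1)) (Fin 2)) (x y : ℕ) (a b : Fin 2) : ℝ :=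
  (bornPair ψ (F.op (Fin.ofNat (K + 1) x) a) (G.op (Fin.ofNat (K + 1) y) b)).re

/-- For an entangled state the local bound `local_le_sum_chainError` is violated by measurements for
which the left-hand side stays away from zero while the right-hand side is as small as desired. -/
theorem exists_chain_measurement [DecidableEq m] [DecidableEq n]
    (hψ : ¬ ∃ (a : m → ℂ) (b : n → ℂ), ∀ i j, ψ (i, j) = a i * b j) :
    ∃ p > 0, ∀ ε > 0, ∃ K : ℕ, Odd K ∧ ∃ (F : Measurement m (Fin (K + 1)) (Fin 2))
      (G : Measurement n (Fin (K + 1)) (Fin 2)), p ≤ chainProb ψ F G 0 K 0 1 ∧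
      ∑ k ∈ Finset.range K, chainError (chainProb ψ F G) k ≤ ε := by
  obtain ⟨s, e, f, h⟩ := exists_isSchmidtPair hψ
  obtain ⟨p, hp, H⟩ := exists_chain (h.pos 0) (h.pos 1)
  refine ⟨p, hp, fun ε hε => ?_⟩
  obtain ⟨K, c, d, hK, hcd, hpK, herr⟩ := H ε hε
  let F := vectorMeasurement (fun k : Fin (K + 1) => planeVec e (c k) (d k))
    (fun k => by rw [star_planeVec_dotProduct h.left, ← sq, ← sq, hcd, Complex.ofReal_one])
  let G := vectorMeasurement (fun k : Fin (K + 1) => planeVec f (c k) (d k))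
    (fun k => by rw [star_planeVec_dotProduct h.right, ← sq, ← sq, hcd, Complex.ofReal_one])
  have hval : ∀ k ≤ K, ((Fin.ofNat (K + 1) k : Fin (K + 1)) : ℕ) = k := fun k hk => by
    simp [Nat.mod_eq_of_lt (Nat.lt_succ_of_le hk)]
  have h01 : ∀ k ≤ K, ∀ l ≤ K, chainProb ψ F G k l 0 1 =
      steeringError (s 0) (s 1) (c k) (d k) (c l) (d l) := fun k hk l hl => by
    have := h.bornPair_left (c k) (d k) (hcd l)
    simp only [chainProb, F, G, vectorMeasurement, hval k hk, hval l hl]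
    simp [this]
  have h10 : ∀ k ≤ K, ∀ l ≤ K, chainProb ψ F G l k 1 0 =
      steeringError (s 0) (s 1) (c k) (d k) (c l) (d l) := fun k hk l hl => by
    have := h.bornPair_right (c k) (d k) (hcd l)
    simp only [chainProb, F, G, vectorMeasurement, hval k hk, hval l hl]
    simp [this]
  refine ⟨K, hK, F, G, ?_, le_of_eq_of_le (Finset.sum_congr rfl fun k hk => ?_) herr⟩
  · rwa [h01 0 (Nat.zero_le K) K le_rfl]
  · have hk' := Finset.mem_range.1 hk
    rw [chainError]
    split_ifs
    · exact h01 k hk'.le (k + 1) hk'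
    · exact h10 k hk'.le (k + 1) hk'

end Schmidt

/-! ### Sums over one label per particle -/

/-- Labels of all particles, grouped in pairs by the edges. -/
def pairEquiv {E : Type*} (Z : E × Fin 2 → Type*) :
    (∀ p, Z p) ≃ ∀ e, Z (e, 0) × Z (e, 1) where
  toFun z e := (z (e, 0), z (e, 1))
  invFun y p := match p with
    | (e, 0) => (y e).1
    | (e, 1) => (y e).2
  left_inv z := by
    funext ⟨e, s⟩
    fin_cases s <;> rfl
  right_inv y := rfl

section PairSums

variable {E R : Type*} [Fintype E] [DecidableEq E] [CommSemiring R] {Z : E × Fin 2 → Type*}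
  [∀ p, Fintype (Z p)]

theorem sum_prod_pairs (h : ∀ e, Z (e, 0) × Z (e, 1) → R) :
    ∑ z : ∀ p, Z p, ∏ e, h e (z (e, 0), z (e, 1)) = ∏ e, ∑ x, h e x := by
  rw [Finset.prod_univ_sum, Fintype.piFinset_univ, ← (pairEquiv Z).sum_comp]
  rfl

theorem sum_sum_prod_pairs (h : ∀ e, Z (e, 0) × Z (e, 1) → Z (e, 0) × Z (e, 1) → R) :
    ∑ z : ∀ p, Z p, ∑ z' : ∀ p, Z p, ∏ e, h e (z (e, 0), z (e, 1)) (z' (e, 0), z' (e, 1)) =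
      ∏ e, ∑ x, ∑ y, h e x y := by
  simp only [fun z : ∀ p, Z p => sum_prod_pairs fun e => h e (z (e, 0), z (e, 1))]
  exact sum_prod_pairs fun e x => ∑ y, h e x y

end PairSums

/-! ### The distribution of particlewise measurements -/

namespace Network

variable {V : Type u} {E : Type w}

/-- Labels of all particles, grouped by the party that holds them. -/
def groupEquiv (N : Network V E) (Z : E × Fin 2 → Type*) :
    (∀ p, Z p) ≃ ∀ v, ∀ p : N.Held v, Z p.1 where
  toFun z _ p := z p.1
  invFun α p := α (N.ends p.1 p.2) ⟨p, rfl⟩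
  left_inv _ := rfl
  right_inv α := by
    funext v ⟨p, hp⟩
    subst hp
    rfl

section Particlewise

variable (N : Network V E) {X A : E × Fin 2 → Type} [∀ p, Fintype (A p)]
  (F : ∀ p : E × Fin 2, Measurement (Fin (N.dim p.1 p.2)) (X p) (A p))

/-- The distribution of the outputs of the two particles of edge `e`. -/
def edgeProb (e : E) (x : X (e, 0)) (y : X (e, 1)) (a : A (e, 0)) (b : A (e, 1)) : ℝ :=
  (bornPair (N.state e) ((F (e, 0)).op x a) ((F (e, 1)).op y b)).re

theorem ofReal_edgeProb (e : E) (x : X (e, 0)) (y : X (e, 1)) (a : A (e, 0)) (b : A (e, 1)) :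
    (N.edgeProb F e x y a b : ℂ) =
      bornPair (N.state e) ((F (e, 0)).op x a) ((F (e, 1)).op y b) :=
  (Complex.eq_re_of_ofReal_le (r := 0)
    (by simpa using bornPair_nonneg _ ((F (e, 0)).posSemidef x a) ((F (e, 1)).posSemidef y b))).symm

theorem edgeProb_nonneg (e : E) (x : X (e, 0)) (y : X (e, 1)) (a : A (e, 0)) (b : A (e, 1)) :
    0 ≤ N.edgeProb F e x y a b :=
  (Complex.nonneg_iff.1
    (bornPair_nonneg _ ((F (e, 0)).posSemidef x a) ((F (e, 1)).posSemidef y b))).1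

theorem sum_edgeProb (e : E) (x : X (e, 0)) (y : X (e, 1)) :
    ∑ ab : A (e, 0) × A (e, 1), N.edgeProb F e x y ab.1 ab.2 = 1 := by
  rw [Fintype.sum_prod_type, ← Complex.ofReal_inj]
  push_cast
  simp only [ofReal_edgeProb]
  rw [bornPair_sum, (F (e, 0)).sum_eq_one, (F (e, 1)).sum_eq_one,
    bornPair_one _ (N.norm_state e)]

variable [Fintype V] [DecidableEq V] [Fintype E] [DecidableEq E]

/-- Particlewise measurements of different edges are independent. -/
theorem distribution_tensor (z : ∀ p, X p) (α : ∀ p, A p) :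
    (N.distribution fun v => Measurement.tensor fun p : N.Held v => F p.1)
      (N.groupEquiv X z) (N.groupEquiv A α) =
      ∏ e, N.edgeProb F e (z (e, 0)) (z (e, 1)) (α (e, 0)) (α (e, 1)) := by
  rw [distribution, ← Complex.ofReal_re (∏ e, _)]
  congr 1
  push_cast
  simp only [ofReal_edgeProb, bornPair]
  refine Eq.trans ?_ (sum_sum_prod_pairs (Z := fun p => Fin (N.dim p.1 p.2)) fun e x y =>
    (F (e, 0)).op (z (e, 0)) (α (e, 0)) x.1 y.1 * (F (e, 1)).op (z (e, 1)) (α (e, 1)) x.2 y.2 *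
      (N.state e y * star (N.state e x)))
  simp only [Matrix.trace, Matrix.diag, Matrix.mul_apply]
  refine Finset.sum_congr rfl fun x _ => Finset.sum_congr rfl fun y _ => ?_
  have h : ∏ v, ∏ p : N.Held v, (F p.1).op (z p.1) (α p.1) (x p.1) (y p.1) =
      ∏ e, ((F (e, 0)).op (z (e, 0)) (α (e, 0)) (x (e, 0)) (y (e, 0)) *
        (F (e, 1)).op (z (e, 1)) (α (e, 1)) (x (e, 1)) (y (e, 1))) := by
    rw [Fintype.prod_fiberwise (fun p : E × Fin 2 => N.ends p.1 p.2)
      fun p => (F p).op (z p) (α p) (x p) (y p), Fintype.prod_prod_type]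
    simp only [Fin.prod_univ_two]
  rw [Finset.prod_mul_distrib, ← h, Finset.prod_mul_distrib, ← star_prod]
  rfl

theorem isDistribution_tensor :
    (N.distribution fun v => Measurement.tensor fun p : N.Held v => F p.1).IsDistribution where
  nonneg χ α := by
    obtain ⟨z, rfl⟩ := (N.groupEquiv X).surjective χ
    obtain ⟨w, rfl⟩ := (N.groupEquiv A).surjective α
    rw [distribution_tensor]
    exact Finset.prod_nonneg fun e _ => N.edgeProb_nonneg F e _ _ _ _
  sum_eq_one χ := by
    obtain ⟨z, rfl⟩ := (N.groupEquiv X).surjective χ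
    rw [← (N.groupEquiv A).sum_comp]
    simp only [distribution_tensor]
    rw [sum_prod_pairs fun e ab => N.edgeProb F e (z (e, 0)) (z (e, 1)) ab.1 ab.2]
    simp only [sum_edgeProb, Finset.prod_const_one]

end Particlewise

variable [Fintype V] [DecidableEq V] [Fintype E] [DecidableEq E]

/-- The distribution of the outputs of the two particles of edge `e` alone, in a distribution `P`
with one binary output per particle. -/
def edgeMarginal (N : Network V E) {X : V → Type*}
    (P : Behavior X fun v => N.Held v → Fin 2) (e : E) (χ : ∀ v, X v) (a b : Fin 2) : ℝ :=
  ∑ α with α (N.ends e 0) ⟨(e, 0), rfl⟩ = a ∧ α (N.ends e 1) ⟨(e, 1), rfl⟩ = b, P χ α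

theorem edgeMarginal_distribution_tensor (N : Network V E) {X : E × Fin 2 → Type}
    (F : ∀ p : E × Fin 2, Measurement (Fin (N.dim p.1 p.2)) (X p) (Fin 2)) (e : E)
    (z : ∀ p, X p) (a b : Fin 2) :
    N.edgeMarginal (N.distribution fun v => Measurement.tensor fun p : N.Held v => F p.1) e
      (N.groupEquiv X z) a b = N.edgeProb F e (z (e, 0)) (z (e, 1)) a b := by
  rw [edgeMarginal, Finset.sum_filter, ← (N.groupEquiv fun _ => Fin 2).sum_comp]
  simp only [distribution_tensor]
  -- The condition on edge `e` becomes a factor in the product over the edges.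
  have h : ∀ w : E × Fin 2 → Fin 2, (if w (e, 0) = a ∧ w (e, 1) = b then
      ∏ e', N.edgeProb F e' (z (e', 0)) (z (e', 1)) (w (e', 0)) (w (e', 1)) else 0) =
      ∏ e', if e' = e → w (e', 0) = a ∧ w (e', 1) = b then
        N.edgeProb F e' (z (e', 0)) (z (e', 1)) (w (e', 0)) (w (e', 1)) else 0 := fun w => by
    rw [Fintype.prod_ite_zero]
    simp
  refine (Finset.sum_congr rfl fun w _ => h w).trans ?_
  refine (sum_prod_pairs (Z := fun _ => Fin 2) fun e' ab =>
    if e' = e → ab.1 = a ∧ ab.2 = b then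
      N.edgeProb F e' (z (e', 0)) (z (e', 1)) ab.1 ab.2 else 0).trans ?_
  rw [Finset.prod_eq_single e (fun e' _ he' => ?_) (by simp)]
  · rw [Finset.sum_eq_single (a, b) (fun ab _ hab => if_neg fun h => hab (Prod.ext_iff.2 (h rfl)))
      (by simp)]
    simp
  · simp only [he', false_imp_iff, if_true]
    exact N.sum_edgeProb F e' _ _

end Network

/-! ### Products across a bipartition -/

/-- The distribution of `s α` when `α` has the distribution `R`. -/
def pushforward {Ω κ : Type*} [Fintype Ω] [DecidableEq κ] (R : Ω → ℝ) (s : Ω → κ) (c : κ) : ℝ :=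
  ∑ α with s α = c, R α

theorem pushforward_nonneg {Ω κ : Type*} [Fintype Ω] [DecidableEq κ] {R : Ω → ℝ}
    (hR : ∀ α, 0 ≤ R α) (s : Ω → κ) (c : κ) : 0 ≤ pushforward R s c :=
  Finset.sum_nonneg fun α _ => hR α

theorem sum_pushforward {Ω κ : Type*} [Fintype Ω] [Fintype κ] [DecidableEq κ] {R : Ω → ℝ}
    (hR : ∑ α, R α = 1) (s : Ω → κ) : ∑ c, pushforward R s c = 1 :=
  (Finset.sum_fiberwise _ _ _).trans hR

/-- Outputs on the two sides of a bipartition are independent. -/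
theorem sum_filter_mul_of_mem_of_notMem {I : Type*} [Fintype I] [DecidableEq I] {A : I → Type*}
    [∀ v, Fintype (A v)] {κ : Type*} [DecidableEq κ] {M : Finset I} {i j : I} (hi : i ∈ M)
    (hj : j ∉ M) (s : A i → κ) (t : A j → κ) (a b : κ)
    (R : (∀ v : {v // v ∈ M}, A v) → ℝ) (S : (∀ v : {v // v ∉ M}, A v) → ℝ) :
    ∑ α : ∀ v, A v with s (α i) = a ∧ t (α j) = b, R (fun v => α v) * S (fun v => α v) =
      pushforward R (fun β => s (β ⟨i, hi⟩)) a * pushforward S (fun γ => t (γ ⟨j, hj⟩)) b := by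
  simp only [pushforward, Finset.sum_filter]
  rw [Finset.sum_mul_sum, ← Fintype.sum_prod_type',
    ← (Equiv.piEquivPiSubtypeProd (· ∈ M) A).sum_comp]
  refine Finset.sum_congr rfl fun α _ => ?_
  simp only [Equiv.piEquivPiSubtypeProd_apply]
  split_ifs <;> simp_all

/-! ### Mixtures over bipartitions fail the chained inequality -/

namespace Network

variable {V : Type u} {E : Type w}

/-- Some edge crosses every bipartition of a connected network. -/
theorem exists_crossing (N : Network V E) (hconn : N.graph.Connected) {M : Set V} {u v : V}
    (hu : u ∈ M) (hv : v ∉ M) :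
    ∃ e, (N.ends e 0 ∈ M ∧ N.ends e 1 ∉ M) ∨ (N.ends e 0 ∉ M ∧ N.ends e 1 ∈ M) := by
  obtain ⟨p⟩ := hconn.preconnected u v
  obtain ⟨d, -, h1, h2⟩ := p.exists_boundary_dart M hu hv
  rcases d.adj.2 with ⟨e, he0, he1⟩ | ⟨e, he0, he1⟩
  · exact ⟨e, .inl ⟨he0 ▸ h1, he1 ▸ h2⟩⟩
  · exact ⟨e, .inr ⟨he0 ▸ h2, he1 ▸ h1⟩⟩

/-- The inputs of the parties when particle `p` is measured in setting `ζ p` of `0, …, K p.1`. -/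
def settings (N : Network V E) (K : E → ℕ) (ζ : E × Fin 2 → ℕ) (v : V) (p : N.Held v) :
    Fin (K p.1.1 + 1) :=
  Fin.ofNat _ (ζ p.1)

/-- Replacing the settings of the two particles of edge `e` by `x` and `y`. -/
def setEdge [DecidableEq E] (ζ : E × Fin 2 → ℕ) (e : E) (x y : ℕ) : E × Fin 2 → ℕ :=
  Function.update (Function.update ζ (e, 0) x) (e, 1) y

/-- The settings at the two ends of every chain. -/
def endSettings (K : E → ℕ) (p : E × Fin 2) : ℕ := if p.2 = 0 then 0 else K p.1

theorem setEdge_endSettings [DecidableEq E] (K : E → ℕ) (e : E) :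
    setEdge (endSettings K) e 0 (K e) = endSettings K := by
  have h0 : Function.update (endSettings K) (e, 0) 0 = endSettings K :=
    Function.update_eq_self (e, 0) (endSettings K)
  rw [setEdge, h0]
  exact Function.update_eq_self (e, 1) (endSettings K)

variable [Fintype V] [DecidableEq V] [Fintype E] [DecidableEq E]

section Product

variable (N : Network V E) (K : E → ℕ)

/-- The two sides of a bipartition, measured independently. -/
def sideProduct {M : Finset V}
    (P : Behavior (fun v : {v // v ∈ M} => ∀ p : N.Held v, Fin (K p.1.1 + 1))
      fun v : {v // v ∈ M} => N.Held v → Fin 2)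
    (P' : Behavior (fun v : {v // v ∉ M} => ∀ p : N.Held v, Fin (K p.1.1 + 1))
      fun v : {v // v ∉ M} => N.Held v → Fin 2) :
    Behavior (fun v => ∀ p : N.Held v, Fin (K p.1.1 + 1)) fun v => N.Held v → Fin 2 :=
  fun χ α => P (fun v => χ v) (fun v => α v) * P' (fun v => χ v) (fun v => α v)

variable {M : Finset V}
  {P : Behavior (fun v : {v // v ∈ M} => ∀ p : N.Held v, Fin (K p.1.1 + 1))
    fun v : {v // v ∈ M} => N.Held v → Fin 2}
  {P' : Behavior (fun v : {v // v ∉ M} => ∀ p : N.Held v, Fin (K p.1.1 + 1))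
    fun v : {v // v ∉ M} => N.Held v → Fin 2}

/-- Across an edge that crosses the bipartition the product of the two sides is local: with the
settings of the other edges held fixed, either side responds to the setting of its own particle
only. -/
theorem exists_local_edgeMarginal (hP : P.IsDistribution) (hP' : P'.IsDistribution)
    (ζ : E × Fin 2 → ℕ) {e : E}
    (he : (N.ends e 0 ∈ M ∧ N.ends e 1 ∉ M) ∨ (N.ends e 0 ∉ M ∧ N.ends e 1 ∈ M)) :
    ∃ f g : ℕ → Fin 2 → ℝ, (∀ k a, 0 ≤ f k a) ∧ (∀ k a, 0 ≤ g k a) ∧ (∀ k, ∑ a, f k a = 1) ∧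
      (∀ k, ∑ a, g k a = 1) ∧ ∀ x y a b,
        N.edgeMarginal (N.sideProduct K P P') e (N.settings K (setEdge ζ e x y)) a b =
          f x a * g y b := by
  have hx : ∀ (v : V) (p : N.Held v), v ≠ N.ends e 0 → ∀ x x' y,
      N.settings K (setEdge ζ e x y) v p = N.settings K (setEdge ζ e x' y) v p := by
    rintro v ⟨p, hp⟩ hv x x' y
    have : p ≠ (e, 0) := by rintro rfl; exact hv hp.symm
    simp [settings, setEdge, Function.update_apply, this]
  have hy : ∀ (v : V) (p : N.Held v), v ≠ N.ends e 1 → ∀ x y y',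
      N.settings K (setEdge ζ e x y) v p = N.settings K (setEdge ζ e x y') v p := by
    rintro v ⟨p, hp⟩ hv x y y'
    have : p ≠ (e, 1) := by rintro rfl; exact hv hp.symm
    simp [settings, setEdge, Function.update_apply, this]
  rcases he with ⟨h0, h1⟩ | ⟨h0, h1⟩
  · refine ⟨fun x a => pushforward (P fun v => N.settings K (setEdge ζ e x 0) v)
        (fun β => β ⟨_, h0⟩ ⟨(e, 0), rfl⟩) a,
      fun y b => pushforward (P' fun v => N.settings K (setEdge ζ e 0 y) v)
        (fun γ => γ ⟨_, h1⟩ ⟨(e, 1), rfl⟩) b,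
      fun _ => pushforward_nonneg (hP.nonneg _) _, fun _ => pushforward_nonneg (hP'.nonneg _) _,
      fun _ => sum_pushforward (hP.sum_eq_one _) _,
      fun _ => sum_pushforward (hP'.sum_eq_one _) _, fun x y a b => ?_⟩
    have e1 : (fun v : {v // v ∈ M} => N.settings K (setEdge ζ e x 0) v) =
        fun v : {v // v ∈ M} => N.settings K (setEdge ζ e x y) v := by
      funext v p
      exact hy v p (fun h => h1 (h ▸ v.2)) x 0 y
    have e2 : (fun v : {v // v ∉ M} => N.settings K (setEdge ζ e 0 y) v) =
        fun v : {v // v ∉ M} => N.settings K (setEdge ζ e x y) v := by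
      funext v p
      exact hx v p (fun h => v.2 (h ▸ h0)) 0 x y
    simp only [e1, e2]
    exact sum_filter_mul_of_mem_of_notMem (A := fun v => N.Held v → Fin 2) h0 h1
      (fun α => α ⟨(e, 0), rfl⟩) (fun α => α ⟨(e, 1), rfl⟩) a b _ _
  · refine ⟨fun x a => pushforward (P' fun v => N.settings K (setEdge ζ e x 0) v)
        (fun β => β ⟨_, h0⟩ ⟨(e, 0), rfl⟩) a,
      fun y b => pushforward (P fun v => N.settings K (setEdge ζ e 0 y) v)
        (fun γ => γ ⟨_, h1⟩ ⟨(e, 1), rfl⟩) b,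
      fun _ => pushforward_nonneg (hP'.nonneg _) _, fun _ => pushforward_nonneg (hP.nonneg _) _,
      fun _ => sum_pushforward (hP'.sum_eq_one _) _,
      fun _ => sum_pushforward (hP.sum_eq_one _) _, fun x y a b => ?_⟩
    have e1 : (fun v : {v // v ∉ M} => N.settings K (setEdge ζ e x 0) v) =
        fun v : {v // v ∉ M} => N.settings K (setEdge ζ e x y) v := by
      funext v p
      exact hy v p (fun h => v.2 (h ▸ h1)) x 0 y
    have e2 : (fun v : {v // v ∈ M} => N.settings K (setEdge ζ e 0 y) v) =
        fun v : {v // v ∈ M} => N.settings K (setEdge ζ e x y) v := by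
      funext v p
      exact hx v p (fun h => h0 (h ▸ v.2)) 0 x y
    simp only [e1, e2, edgeMarginal]
    simp only [and_comm (a := _ = a)]
    rw [mul_comm]
    exact sum_filter_mul_of_mem_of_notMem (A := fun v => N.Held v → Fin 2) h1 h0
      (fun α => α ⟨(e, 1), rfl⟩) (fun α => α ⟨(e, 0), rfl⟩) b a _ _

/-- The error of the chain on edge `e` in a distribution `Q` of binary outputs, while the settings
of the other edges stay at the ends of their chains. -/
def edgeError (Q : Behavior (fun v => ∀ p : N.Held v, Fin (K p.1.1 + 1))
    fun v => N.Held v → Fin 2) (e : E) : ℝ :=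
  ∑ k ∈ Finset.range (K e), chainError (fun x y a b =>
    N.edgeMarginal Q e (N.settings K (setEdge (endSettings K) e x y)) a b) k

theorem edgeError_nonneg {Q : Behavior (fun v => ∀ p : N.Held v, Fin (K p.1.1 + 1))
    fun v => N.Held v → Fin 2} (hQ : ∀ χ α, 0 ≤ Q χ α) (e : E) : 0 ≤ N.edgeError K Q e := by
  refine Finset.sum_nonneg fun k _ => ?_
  rw [chainError]
  split_ifs <;> exact Finset.sum_nonneg fun _ _ => hQ _ _

/-- The total error of all chains in a distribution `Q` of binary outputs. -/
def totalError (Q : Behavior (fun v => ∀ p : N.Held v, Fin (K p.1.1 + 1))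
    fun v => N.Held v → Fin 2) : ℝ :=
  ∑ e, N.edgeError K Q e

/-- A single term of a mixture: the probability that all chains start in `0` and end in `1` is
bounded by the error on an edge that crosses the bipartition. -/
theorem sideProduct_le_totalError (hK : ∀ e, Odd (K e)) (hP : P.IsDistribution)
    (hP' : P'.IsDistribution) (hconn : N.graph.Connected) (hM : M ≠ ∅) (hM' : M ≠ Finset.univ) :
    N.sideProduct K P P' (N.settings K (endSettings K)) (fun _ p => p.1.2) ≤
      N.totalError K (N.sideProduct K P P') := by
  have hnn : ∀ χ α, 0 ≤ N.sideProduct K P P' χ α := fun χ α =>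
    mul_nonneg (hP.nonneg _ _) (hP'.nonneg _ _)
  obtain ⟨u, hu⟩ := Finset.nonempty_iff_ne_empty.2 hM
  obtain ⟨v, hv⟩ : ∃ v, v ∉ M := by
    by_contra! h
    exact hM' (Finset.eq_univ_iff_forall.2 h)
  obtain ⟨e, he⟩ := N.exists_crossing hconn (M := (M : Set V)) hu hv
  obtain ⟨f, g, hf, hg, hf1, hg1, hfg⟩ :=
    N.exists_local_edgeMarginal K hP hP' (endSettings K) (e := e) (by simpa using he)
  calc N.sideProduct K P P' (N.settings K (endSettings K)) (fun _ p => p.1.2)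
      ≤ N.edgeMarginal (N.sideProduct K P P') e (N.settings K (endSettings K)) 0 1 :=
        Finset.single_le_sum (f := fun α => N.sideProduct K P P' (N.settings K (endSettings K)) α)
          (fun _ _ => hnn _ _) (by simp)
    _ = f 0 0 * g (K e) 1 := by rw [← hfg, setEdge_endSettings]
    _ ≤ N.edgeError K (N.sideProduct K P P') e := by
        simp only [edgeError, hfg]
        exact local_le_sum_chainError hf hg hf1 hg1 (hK e)
    _ ≤ N.totalError K (N.sideProduct K P P') :=
        Finset.single_le_sum (fun e _ => N.edgeError_nonneg K hnn e) (Finset.mem_univ e)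

theorem totalError_sum {ι : Type*} (s : Finset ι) (q : ι → ℝ)
    (Q : ι → Behavior (fun v => ∀ p : N.Held v, Fin (K p.1.1 + 1)) fun v => N.Held v → Fin 2) :
    N.totalError K (fun χ α => ∑ i ∈ s, q i * Q i χ α) = ∑ i ∈ s, q i * N.totalError K (Q i) := by
  have h1 : ∀ e χ a b, N.edgeMarginal (fun χ α => ∑ i ∈ s, q i * Q i χ α) e χ a b =
      ∑ i ∈ s, q i * N.edgeMarginal (Q i) e χ a b := fun e χ a b => by
    simp only [edgeMarginal, Finset.mul_sum]
    exact Finset.sum_comm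
  have h2 : ∀ (T : ι → ℕ → ℕ → Fin 2 → Fin 2 → ℝ) k,
      chainError (fun x y a b => ∑ i ∈ s, q i * T i x y a b) k =
      ∑ i ∈ s, q i * chainError (T i) k := fun T k => by
    simp only [chainError]
    split_ifs <;> rfl
  simp only [totalError, edgeError, h1, h2 fun i x y a b => N.edgeMarginal (Q i) _ _ a b,
    Finset.mul_sum]
  exact (Finset.sum_congr rfl fun e _ => Finset.sum_comm).trans Finset.sum_comm

end Product

/-- In a mixture over bipartitions, the probability that all chains start in output `0` and end in
output `1` is at most the total error of the chains. -/
theorem le_totalError_of_isBilocalMixture (N : Network V E) {K : E → ℕ} (hK : ∀ e, Odd (K e))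
    (hconn : N.graph.Connected)
    {Q : Behavior (fun v => ∀ p : N.Held v, Fin (K p.1.1 + 1)) fun v => N.Held v → Fin 2}
    (hQ : Q.IsBilocalMixture) :
    Q (N.settings K (endSettings K)) (fun _ p => p.1.2) ≤ N.totalError K Q := by
  obtain ⟨m, q, PM, PMc, hq, -, hns, hmix⟩ := hQ
  have hQ' : Q = fun χ α => ∑ i ∈ (Finset.univ.filter fun M : Finset V =>
      M ≠ ∅ ∧ M ≠ Finset.univ) ×ˢ (Finset.univ : Finset (Fin m)),
      q i.1 i.2 * N.sideProduct K (PM i.1 i.2) (PMc i.1 i.2) χ α := by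
    funext χ α
    rw [hmix, Finset.sum_product]
    simp only [sideProduct, mul_assoc]
  rw [hQ', totalError_sum]
  refine Finset.sum_le_sum fun i hi => mul_le_mul_of_nonneg_left ?_ (hq _ _)
  obtain ⟨h1, h2⟩ : i.1 ≠ ∅ ∧ i.1 ≠ Finset.univ := by simpa using hi
  obtain ⟨hP, hP'⟩ := hns i.1 h1 h2 i.2
  exact N.sideProduct_le_totalError K hK hP.toIsDistribution hP'.toIsDistribution hconn h1 h2

/-- Chains of measurements on all edges violate the bound of `le_totalError_of_isBilocalMixture`. -/
theorem isGMNLParticlewise_of_connected (N : Network V E) (hconn : N.graph.Connected)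
    (hent : ∀ e, N.IsEntangled e) : N.IsGMNLParticlewise := by
  choose p hp H using fun e => exists_chain_measurement (hent e)
  -- The error `ε` per edge is chosen so that the total error `|E| ε` stays below `∏ e, p e`.
  set ε : ℝ := (∏ e, p e) / (Fintype.card E + 1) with hε
  have hprod : 0 < ∏ e, p e := Finset.prod_pos fun e _ => hp e
  have hε0 : 0 < ε := by positivity
  choose K hK F₀ F₁ hpK herr using fun e => H e ε hε0
  let F : ∀ r : E × Fin 2, Measurement (Fin (N.dim r.1 r.2)) (Fin (K r.1 + 1)) (Fin 2) := fun r =>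
    match r with
    | (e, 0) => F₀ e
    | (e, 1) => F₁ e
  refine ⟨fun r => K r.1 + 1, fun _ => 2, F, N.isDistribution_tensor F, fun hmix => ?_⟩
  have hle := N.le_totalError_of_isBilocalMixture hK hconn hmix
  have hset : ∀ ζ : E × Fin 2 → ℕ, N.settings K ζ =
      N.groupEquiv (fun r => Fin (K r.1 + 1)) fun r => Fin.ofNat _ (ζ r) := fun ζ => rfl
  have hedge : ∀ e x y a b, N.edgeProb F e (Fin.ofNat _ x) (Fin.ofNat _ y) a b =
      chainProb (N.state e) (F₀ e) (F₁ e) x y a b := fun e x y a b => rfl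
  have hlow : ∏ e, p e ≤ (N.distribution fun v => Measurement.tensor fun r : N.Held v => F r.1)
      (N.settings K (endSettings K)) (fun _ r => r.1.2) := by
    rw [hset]
    refine le_of_le_of_eq ?_ (N.distribution_tensor F _ fun r => r.2).symm
    refine Finset.prod_le_prod (fun e _ => (hp e).le) fun e _ => ?_
    exact hpK e
  have hup : N.totalError K (N.distribution fun v => Measurement.tensor fun r : N.Held v => F r.1)
      ≤ Fintype.card E * ε := by
    rw [← nsmul_eq_mul, ← Finset.card_univ]
    refine Finset.sum_le_card_nsmul _ _ _ fun e _ => ?_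
    have : (fun x y a b => N.edgeMarginal
        (N.distribution fun v => Measurement.tensor fun r : N.Held v => F r.1) e
        (N.settings K (setEdge (endSettings K) e x y)) a b) =
        chainProb (N.state e) (F₀ e) (F₁ e) := by
      funext x y a b
      rw [hset, edgeMarginal_distribution_tensor, hedge]
      simp [setEdge]
    rw [edgeError, this]
    exact herr e
  have hlt : Fintype.card E * ε < ∏ e, p e := by
    have : (Fintype.card E + 1) * ε = ∏ e, p e := by rw [hε]; field_simp
    linarith
  linarith

theorem IsGMNLParticlewise.isGMNL {N : Network V E} (h : N.IsGMNLParticlewise) : N.IsGMNL := by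
  obtain ⟨nX, nA, F, hF⟩ := h
  exact ⟨fun v => ∀ p : N.Held v, Fin (nX p.1), fun v => ∀ p : N.Held v, Fin (nA p.1),
    fun _ => inferInstance, fun _ => inferInstance, _, hF⟩

end Network

/-- Any connected network of bipartite pure entangled states is genuinely multipartite
nonlocal, already with individual measurements on each particle. -/
theorem theorem1 {V : Type u} {E : Type w} [Fintype V] [DecidableEq V] [Nontrivial V]
    [Fintype E] [DecidableEq E] (N : Network V E)
    (hconn : N.graph.Connected) (hent : ∀ e, N.IsEntangled e) :
    N.IsGMNL ∧ N.IsGMNLParticlewise :=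
  have h := N.isGMNLParticlewise_of_connected hconn hent
  ⟨h.isGMNL, h⟩
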